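/- Let $\Lambda$ be a finite discrete alphabet, let $\mathbb G=\mathbb Z$ (two-sided case) or $\mathbb G=\mathbb N_0$ (one-sided case), and let $X\subset\Lambda^{\mathbb G}$ be a subshift, i.e. a closed set invariant under the shift $(\sigma x)(i)=x(i+1)$ (that is, $\sigma(X)=X$ in the two-sided case and $\sigma(X)\subset X$ in the one-sided case). Let $\mathcal B^*(X)$ be the set of all nonempty finite blocks $x|_{[i,i+k)}$ occurring in elements $x\in X$, let $\mathcal M(X)$ be the set of Borel probability measures on $X$ with the weak-$\star$ topology, and let $\mathcal M_\sigma^{\mathrm{erg}}(X)\subset\mathcal M_\sigma(X)\subset\mathcal M(X)$ be the sets of ergodic and of shift-invariant measures. For $C\in\Lambda^l$, put $p(C)=\frac1{|B|}\,|\{i: 0\le i\le |B|-l,\ B|_{[i,i+l)}=C\}|$ if $p=B$ is a block (so $p(C)=0$ if $l>|B|$), and $p(C)=\mu(\{x\in X:x|_{[0,l)}=C\})$ if $p=\mu$ is a measure. Equip the disjoint union $\mathcal B^*(X)\cup\mathcal M(X)$ with the topology given by the (pseudo)metric $$d^*(p,q)=\sum_{l=1}^{\infty}2^{-l}\sum_{C\in\Lambda^l}|p(C)-q(C)|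 .$$ The upper Banach density of $A\subset\mathbb G$ is $\overline d_{\mathrm{Ban}}(A)=\inf_{N\ge1}\sup_{i\in\mathbb G}\frac{|A\cap[i,i+N)|}{N}$. **Theorem.** Suppose that $\mathcal M_\sigma(X)$ is a Bauer simplex, i.e. that $\mathcal M_\sigma^{\mathrm{erg}}(X)$ is closed in $\mathcal M(X)$. Let $\mathcal U\supset\mathcal M_\sigma^{\mathrm{erg}}(X)$ be an open set in $\mathcal B^*(X)\cup\mathcal M(X)$. Then for every $\varepsilon>0$ there exists $k_0\in\mathbb N$ such that for every $x\in X$ and every decomposition of $x$ as an infinite concatenation of consecutive finite nonempty blocks $C_j$ (bi-infinite if $\mathbb G=\mathbb Z$, starting at coordinate $0$ if $\mathbb G=\mathbb N_0$) whose lengths are all at least $k_0$ and bounded above, the set of those coordinates which belong to blocks $C_j$ that are not $\mathcal U$-ergodic (i.e. $C_j\notin\mathcal U$) has upper Banach density smaller than $\varepsilon$. -/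

import Mathlib

open MeasureTheory

noncomputable section

namespace Symbolic

/-- The shift by `i`, i.e. `(σ^i x)(j) = x(i + j)`.  The index set `G` is `ℤ` (two-sided
sequences) or `ℕ` (one-sided sequences, including the coordinate `0`). -/
def shift {G Λ : Type*} [Add G] (i : G) (x : G → Λ) : G → Λ := fun j => x (i + j)

/-- A subshift over the alphabet `Λ`: a closed subset of `Λ^G` which is invariant under the action
of `G` by shifts.  For `G = ℕ` invariance says `σ(X) ⊆ X`; for `G = ℤ` it says `σ(X) = X`. -/
structure Subshift (G Λ : Type*) [Add G] [TopologicalSpace Λ] where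
  carrier : Set (G → Λ)
  isClosed : IsClosed carrier
  shift_mem : ∀ (i : G), ∀ x ∈ carrier, shift i x ∈ carrier

/-- The frequency of occurrences of the block `C` in the block `B`. It is `0` if `C` is longer
than `B`. -/
def freq {Λ : Type*} {k l : ℕ} (B : Fin k → Λ) (C : Fin l → Λ) : ℝ :=
  (Set.ncard {i : ℕ | ∃ h : i + l ≤ k, ∀ j : Fin l, B ⟨i + j, by omega⟩ = C j} : ℝ) / k

/-- Upper Banach density of a subset of `ℤ` or `ℕ`. -/
def upperBanachDensity {G : Type*} [AddMonoidWithOne G] [Preorder G] (A : Set G) : ℝ :=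
  ⨅ N : ℕ+, ⨆ i : G, ((A ∩ Set.Ico i (i + ((N : ℕ) : G))).ncard : ℝ) / (N : ℕ)

namespace Subshift

section Basic

variable {G Λ : Type*} [AddMonoidWithOne G] [TopologicalSpace Λ]

/-- The points of the subshift. -/
abbrev Pt (X : Subshift G Λ) : Type _ := ↥X.carrier

/-- The shift transformation `σ : X → X`, `(σ x)(j) = x(1 + j)`. -/
def σ (X : Subshift G Λ) (x : X.Pt) : X.Pt := ⟨shift 1 x.1, X.shift_mem 1 x.1 x.2⟩

/-- The set `B*(X)` of all (nonempty) blocks that occur in the elements of `X`. -/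
structure Block (X : Subshift G Λ) where
  length : ℕ
  length_pos : 0 < length
  toFun : Fin length → Λ
  occurs : ∃ x ∈ X.carrier, ∃ i : G, ∀ j : Fin length, toFun j = x (i + ((j : ℕ) : G))

/-- The block `x|_{[i, i + k)}`. -/
def blockAt (X : Subshift G Λ) (x : X.Pt) (i : G) (k : ℕ) (hk : 0 < k) : X.Block where
  length := k
  length_pos := hk
  toFun := fun j => x.1 (i + ((j : ℕ) : G))
  occurs := ⟨x.1, x.2, i, fun _ => rfl⟩

/-- The cylinder `[C] = {x ∈ X : x|_{[0, l)} = C}`. -/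
def cylinder (X : Subshift G Λ) {l : ℕ} (C : Fin l → Λ) : Set X.Pt :=
  {x | ∀ j : Fin l, x.1 ((j : ℕ) : G) = C j}

end Basic

section Measures

variable {G Λ : Type*} [AddMonoidWithOne G] [TopologicalSpace Λ] [MeasurableSpace Λ]

/-- The disjoint union `B*(X) ∪ M(X)` of the blocks of `X` and the Borel probability measures
on `X`. -/
inductive BlockOrMeasure (X : Subshift G Λ)
  | block (B : X.Block)
  | measure (μ : ProbabilityMeasure X.Pt)

/-- `Fr_B(C)` for a block `B`, and `μ([C])` for a measure `μ`. -/
def BlockOrMeasure.weight {X : Subshift G Λ} {l : ℕ} (C : Fin l → Λ) : X.BlockOrMeasure → ℝ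
  | .block B => freq B.toFun C
  | .measure μ => (μ : Measure X.Pt).real (X.cylinder C)

/-- The function `d*` on `B*(X) ∪ M(X)`:
`d*(p, q) = ∑_{l ≥ 1} 2^{-l} ∑_{C ∈ Λ^l} |p(C) - q(C)|`, where `p(C)` stands for `Fr_p(C)` if `p` is
a block and for `p([C])` if `p` is a measure. -/
def dStar [Fintype Λ] {X : Subshift G Λ} (p q : X.BlockOrMeasure) : ℝ :=
  ∑' l : ℕ, (1 / 2 : ℝ) ^ (l + 1) * ∑ C : Fin (l + 1) → Λ, |p.weight C - q.weight C|

end Measures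

section Metric

set_option linter.unusedSectionVars false

variable {G Λ : Type*} [AddMonoidWithOne G] [TopologicalSpace Λ] [MeasurableSpace Λ]
  [MeasurableSingletonClass Λ] [Fintype Λ] {X : Subshift G Λ}

theorem freq_nonneg {Λ : Type*} {k l : ℕ} (B : Fin k → Λ) (C : Fin l → Λ) : 0 ≤ freq B C := by
  unfold freq; positivity

theorem weight_nonneg {l : ℕ} (C : Fin l → Λ) (p : X.BlockOrMeasure) : 0 ≤ p.weight C := by
  cases p with
  | block B => exact freq_nonneg _ _
  | measure μ => exact measureReal_nonneg

theorem sum_freq_le_one {Λ : Type*} [Fintype Λ] {k l : ℕ} (B : Fin k → Λ) :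
    ∑ C : Fin (l + 1) → Λ, freq B C ≤ 1 := by
  classical
  unfold freq
  rw [← Finset.sum_div]
  apply div_le_one_of_le₀ _ (by positivity)
  have key : ∀ C : Fin (l + 1) → Λ,
      Set.ncard {i : ℕ | ∃ h : i + (l + 1) ≤ k, ∀ j : Fin (l + 1), B ⟨i + j, by omega⟩ = C j} =
        ((Finset.range k).filter (fun i : ℕ =>
          ∃ h : i + (l + 1) ≤ k, ∀ j : Fin (l + 1), B ⟨i + j, by omega⟩ = C j)).card := by
    intro C
    rw [← Set.ncard_coe_finset]
    congr 1
    ext i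
    simp only [Set.mem_ofPred_eq, Finset.coe_filter, Finset.mem_range]
    constructor
    · rintro ⟨h, h'⟩
      exact ⟨by omega, h, h'⟩
    · exact fun h => h.2
  simp only [key]
  rw [← Nat.cast_sum, ← Finset.card_biUnion]
  · norm_cast
    refine (Finset.card_le_card (t := Finset.range k) ?_).trans (by simp)
    intro i hi
    simp only [Finset.mem_biUnion, Finset.mem_filter] at hi
    exact hi.choose_spec.2.1
  · intro C _ D _ hCD
    simp only [Function.onFun]
    rw [Finset.disjoint_left]
    intro i hi hi'
    simp only [Finset.mem_filter] at hi hi'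
    obtain ⟨_, h, h1⟩ := hi
    obtain ⟨_, _, h2⟩ := hi'
    exact hCD (funext fun j => (h1 j).symm.trans (h2 j))

theorem measurableSet_cylinder {l : ℕ} (C : Fin l → Λ) : MeasurableSet (X.cylinder C) := by
  have : X.cylinder C = ⋂ j : Fin l, (fun x : X.Pt => x.1 ((j : ℕ) : G)) ⁻¹' {C j} := by
    ext x; simp [cylinder]
  rw [this]
  refine MeasurableSet.iInter fun j => ?_
  exact ((measurable_pi_apply _).comp measurable_subtype_coe) (measurableSet_singleton _)

theorem sum_weight_le_one {l : ℕ} (p : X.BlockOrMeasure) :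
    ∑ C : Fin (l + 1) → Λ, p.weight C ≤ 1 := by
  cases p with
  | block B => exact sum_freq_le_one _
  | measure μ =>
    refine (sum_measureReal_le_measureReal_univ (s := Finset.univ) (μ := (μ : Measure X.Pt))
      (fun C _ => measurableSet_cylinder C) ?_).trans probReal_univ.le
    intro C _ D _ hCD
    simp only [Function.onFun]
    rw [Set.disjoint_left]
    intro x hx hx'
    exact hCD (funext fun j => (hx j).symm.trans (hx' j))

theorem summable_dStar (p q : X.BlockOrMeasure) :
    Summable fun l : ℕ =>
      (1 / 2 : ℝ) ^ (l + 1) * ∑ C : Fin (l + 1) → Λ, |p.weight C - q.weight C| := by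
  refine Summable.of_nonneg_of_le (fun l => by positivity) (fun l => ?_)
    (summable_geometric_two : Summable fun l : ℕ => (1 / 2 : ℝ) ^ l)
  have h : ∑ C : Fin (l + 1) → Λ, |p.weight C - q.weight C| ≤ 2 := by
    calc _ ≤ ∑ C : Fin (l + 1) → Λ, (p.weight C + q.weight C) := by
          refine Finset.sum_le_sum fun C _ => ?_
          have h1 := weight_nonneg C p
          have h2 := weight_nonneg C q
          rw [abs_le]; constructor <;> linarith
      _ ≤ 2 := by
          rw [Finset.sum_add_distrib]
          have h1 := sum_weight_le_one (l := l) p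
          have h2 := sum_weight_le_one (l := l) q
          linarith
  calc _ ≤ (1 / 2 : ℝ) ^ (l + 1) * 2 := by gcongr
    _ = (1 / 2 : ℝ) ^ l := by rw [pow_succ]; ring

/-- `B*(X) ∪ M(X)` with the distance `d*`; its topology is the one given by the `d*`-balls.
(Two measures on a two-sided subshift have distance `0` if they agree on all cylinders `[C]`; among
invariant measures, and between blocks, or between a block and a measure, distance `0` means
equality.) -/
instance instPseudoMetricSpace : PseudoMetricSpace X.BlockOrMeasure where
  dist := dStar
  dist_self p := by simp [dStar]
  dist_comm p q := by simp only [dStar, abs_sub_comm]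
  dist_triangle p q r := by
    unfold dStar
    rw [← (summable_dStar p q).tsum_add (summable_dStar q r)]
    refine (summable_dStar p r).tsum_le_tsum (fun l => ?_)
      ((summable_dStar p q).add (summable_dStar q r))
    rw [← mul_add, ← Finset.sum_add_distrib]
    gcongr
    exact abs_sub_le _ _ _

end Metric

section Ergodic

variable {G Λ : Type*} [AddMonoidWithOne G] [Countable G] [TopologicalSpace Λ]
  [DiscreteTopology Λ] [Finite Λ] [MeasurableSpace Λ] [BorelSpace Λ]

/-- The set of ergodic `σ`-invariant Borel probability measures on `X`. -/
def ergodicMeasures (X : Subshift G Λ) : Set (ProbabilityMeasure X.Pt) :=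
  {μ | Ergodic X.σ (μ : Measure X.Pt)}

/-- The simplex of invariant measures is a Bauer simplex: its set of extreme points, that is the set
of ergodic measures, is closed in the weak-star topology. -/
def IsBauer (X : Subshift G Λ) : Prop := IsClosed X.ergodicMeasures

end Ergodic

end Subshift

/-- A decomposition of the index set `G` (`ℤ` or `ℕ`), and thereby of every sequence indexed
by `G`, into consecutive nonempty finite intervals `[start j, start j + length j)`, `j ∈ G`. -/
structure Decomposition (G : Type*) [AddMonoidWithOne G] [Preorder G] where
  start : G → G
  length : G → ℕ
  length_pos : ∀ j, 0 < length j
  start_succ : ∀ j, start (j + 1) = start j + (length j : G)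
  covers : ∀ i : G, ∃ j : G, i ∈ Set.Ico (start j) (start j + (length j : G))

/-- The block `C_j` of the decomposition of `x`. -/
def Decomposition.block {G Λ : Type*} [AddMonoidWithOne G] [Preorder G] [TopologicalSpace Λ]
    (D : Decomposition G) (X : Subshift G Λ) (x : X.Pt) (j : G) : X.Block :=
  X.blockAt x (D.start j) (D.length j) (D.length_pos j)

/-- The set of coordinates pertaining to those blocks `C_j` in the decomposition of `x` which are
not `U`-ergodic, i.e. are not elements of `U`. -/
def Decomposition.nonergodicCoords {G Λ : Type*} [AddMonoidWithOne G] [Preorder G]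
    [TopologicalSpace Λ] [MeasurableSpace Λ] (D : Decomposition G) (X : Subshift G Λ)
    (U : Set X.BlockOrMeasure) (x : X.Pt) : Set G :=
  {i | ∃ j : G, i ∈ Set.Ico (D.start j) (D.start j + (D.length j : G)) ∧
    Subshift.BlockOrMeasure.block (D.block X x j) ∉ U}

end Symbolic

end

/-! Suppose long blocks outside `U` keep density at least `ε`. Sort all blocks into finitely many
types, recording membership in `U` and the frequencies of finitely many short words rounded to a
fine grid. Mark every coordinate of `x` by the type of its block; this gives a point of the product
of `X` with a full shift over the set of types.

For blocks of length at least `k`, `exists_ergodic_marked` finds an ergodic measure on the orbit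
closure of the marked point. It charges the bad types with mass at least `ε / 2`, its marker changes
with frequency at most `1 / k`, and its mass on "marker `q` and word `C`" is tied to the frequency
of `C` in the blocks of type `q`. The upper bound on the lengths keeps the boundary errors of finite
windows bounded.

Let `k` tend to infinity (`exists_ergodic_of_marked`). The limit need not be ergodic, but its
projection `ν` to `X` is a limit of ergodic measures, hence ergodic because the simplex is Bauer.
The marker is now invariant almost everywhere, so conditioning on a marker `q` of positive mass
gives an invariant measure whose projection is absolutely continuous with respect to `ν`, and so
equals `ν` (`real_projection_eq_of_markChangeSet_null`). Therefore `ν` has nearly the word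
frequencies of the blocks of a bad type `q`. Compactness of the ergodic measures makes "nearly"
uniform, and these blocks must lie in `U`, a contradiction. -/

open Filter Topology Set

noncomputable section

namespace Symbolic

/-! ### Invariant and ergodic measures from Birkhoff sums -/

section Invariant

variable {Z : Type*} [TopologicalSpace Z] [CompactSpace Z] [TopologicalSpace.MetrizableSpace Z]
  [MeasurableSpace Z] [BorelSpace Z]

omit [TopologicalSpace.MetrizableSpace Z] in
theorem integrable_continuousMap (F : C(Z, ℝ)) (μ : Measure Z) [IsFiniteMeasure μ] :
    Integrable F μ :=
  (BoundedContinuousFunction.mkOfCompact F).integrable μ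

omit [CompactSpace Z] in
theorem measurePreserving_of_integral_comp_eq {T : Z → Z} (hT : Continuous T)
    (μ : ProbabilityMeasure Z) (h : ∀ f : C(Z, ℝ), ∫ y, f (T y) ∂(μ : Measure Z) = ∫ y, f y ∂μ) :
    MeasurePreserving T (μ : Measure Z) μ := by
  refine ⟨hT.measurable, ?_⟩
  have : IsProbabilityMeasure ((μ : Measure Z).map T) :=
    Measure.isProbabilityMeasure_map hT.measurable.aemeasurable
  apply ext_of_forall_integral_eq_of_IsFiniteMeasure
  intro f
  rw [integral_map hT.measurable.aemeasurable f.continuous.aestronglyMeasurable]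
  exact h f.toContinuousMap

theorem isClosed_setOf_measurePreserving {T : Z → Z} (hT : Continuous T) :
    IsClosed {μ : ProbabilityMeasure Z | MeasurePreserving T (μ : Measure Z) μ} := by
  have : {μ : ProbabilityMeasure Z | MeasurePreserving T (μ : Measure Z) μ} =
      ⋂ f : C(Z, ℝ), {μ : ProbabilityMeasure Z |
        ∫ y, f (T y) ∂(μ : Measure Z) = ∫ y, f y ∂(μ : Measure Z)} := by
    ext μ
    simp only [mem_iInter, mem_ofPred_eq]
    refine ⟨fun h f => ?_, fun h => measurePreserving_of_integral_comp_eq hT μ h⟩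
    conv_rhs => rw [← h.map_eq]
    rw [integral_map hT.measurable.aemeasurable f.continuous.aestronglyMeasurable]
  rw [this]
  refine isClosed_iInter fun f => isClosed_eq ?_ ?_
  · exact ProbabilityMeasure.continuous_integral_continuousMap (f.comp ⟨T, hT⟩)
  · exact ProbabilityMeasure.continuous_integral_continuousMap f

/-- The empirical measure of the orbit segment `y, T y, …, T^[N] y`. -/
def empirical (T : Z → Z) (N : ℕ) (y : Z) : ProbabilityMeasure Z :=
  ⟨((N + 1 : ℕ) : ENNReal)⁻¹ • ∑ n ∈ Finset.range (N + 1), Measure.dirac (T^[n] y), ⟨by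
    simp only [Measure.smul_apply, Measure.finsetSum_apply, measure_univ, smul_eq_mul,
      Finset.sum_const, Finset.card_range, nsmul_eq_mul, mul_one]
    exact ENNReal.inv_mul_cancel (by simp) (ENNReal.natCast_ne_top _)⟩⟩

theorem integral_empirical (T : Z → Z) (N : ℕ) (y : Z) (f : C(Z, ℝ)) :
    ∫ w, f w ∂(empirical T N y : Measure Z) = (N + 1 : ℝ)⁻¹ * birkhoffSum T f (N + 1) y := by
  simp only [empirical, ProbabilityMeasure.coe_mk]
  rw [integral_smul_measure, integral_finsetSum_measure fun i _ => integrable_continuousMap f _]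
  have : ((N : ENNReal) + 1).toReal = N + 1 := by
    rw [ENNReal.toReal_add (by simp) (by simp)]; simp
  simp [birkhoffSum, integral_dirac, this]

/-- The Krylov–Bogolyubov argument: empirical measures of longer and longer orbit segments have an
ultrafilter limit, which is invariant because Birkhoff sums of `f ∘ T` and `f` differ by at most `2
* ‖f‖`. -/
theorem exists_invariant_of_birkhoffSum_ge {T : Z → Z} (hT : Continuous T) (F : C(Z, ℝ)) {c : ℝ}
    (h : ∀ N : ℕ, ∃ y, c * (N + 1) ≤ birkhoffSum T F (N + 1) y) :
    ∃ μ : ProbabilityMeasure Z, MeasurePreserving T (μ : Measure Z) μ ∧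
      c ≤ ∫ y, F y ∂(μ : Measure Z) := by
  choose y hy using h
  obtain ⟨μ, -, hμ⟩ := isCompact_univ.ultrafilter_le_nhds
    ((hyperfilter ℕ : Ultrafilter ℕ).map fun N => empirical T N (y N)) (by simp)
  have hlim : Tendsto (fun N => empirical T N (y N)) (hyperfilter ℕ) (𝓝 μ) := hμ
  have hint (f : C(Z, ℝ)) : Tendsto (fun N : ℕ => (N + 1 : ℝ)⁻¹ * birkhoffSum T f (N + 1) (y N))
      (hyperfilter ℕ) (𝓝 (∫ w, f w ∂(μ : Measure Z))) := by
    have := ((ProbabilityMeasure.continuous_integral_continuousMap f).tendsto μ).comp hlim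
    simpa only [Function.comp_def, integral_empirical] using this
  have hle : (hyperfilter ℕ : Filter ℕ) ≤ atTop := Nat.hyperfilter_le_atTop
  refine ⟨μ, measurePreserving_of_integral_comp_eq hT μ fun f => ?_, ?_⟩
  · have h1 := (hint (f.comp ⟨T, hT⟩)).sub (hint f)
    have h2 : Tendsto (fun N : ℕ => (2 * ‖f‖) * (1 / ((N : ℝ) + 1))) (hyperfilter ℕ) (𝓝 0) := by
      simpa using (tendsto_one_div_add_atTop_nhds_zero_nat.const_mul (2 * ‖f‖)).mono_left hle
    refine sub_eq_zero.1 (tendsto_nhds_unique h1 (squeeze_zero_norm (fun N => ?_) h2))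
    · rw [← mul_sub]
      have : birkhoffSum T (f.comp ⟨T, hT⟩) (N + 1) (y N) - birkhoffSum T f (N + 1) (y N) =
          f (T^[N + 1] (y N)) - f (y N) := by
        rw [← birkhoffSum_apply_sub_birkhoffSum]
        simp only [birkhoffSum, ContinuousMap.comp_apply, ContinuousMap.coe_mk,
          ← Function.iterate_succ_apply', ← Function.iterate_succ_apply]
      rw [this, norm_mul, Real.norm_of_nonneg (by positivity), one_div, mul_comm]
      gcongr
      calc _ ≤ ‖f (T^[N + 1] (y N))‖ + ‖f (y N)‖ := norm_sub_le _ _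
        _ ≤ _ := by linarith [f.norm_coe_le_norm (T^[N + 1] (y N)), f.norm_coe_le_norm (y N)]
  · refine ge_of_tendsto (hint F) (Eventually.of_forall fun N => ?_)
    rw [inv_mul_eq_div, le_div_iff₀ (by positivity)]
    exact hy N

/-- The invariant measures maximizing the integral of `F` form a compact face, and an extreme point
of a face is extreme among all invariant measures, hence ergodic. -/
theorem exists_ergodic_of_birkhoffSum_ge {T : Z → Z} (hT : Continuous T) (F : C(Z, ℝ)) {c : ℝ}
    (h : ∀ N : ℕ, ∃ y, c * (N + 1) ≤ birkhoffSum T F (N + 1) y) :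
    ∃ μ : ProbabilityMeasure Z, Ergodic T (μ : Measure Z) ∧ c ≤ ∫ y, F y ∂(μ : Measure Z) := by
  set P : Set (ProbabilityMeasure Z) := {μ | MeasurePreserving T (μ : Measure Z) μ} with hP
  have hPc : IsCompact P := (isClosed_setOf_measurePreserving hT).isCompact
  obtain ⟨μ₀, hμ₀, hc⟩ := exists_invariant_of_birkhoffSum_ge hT F h
  have hFc := ProbabilityMeasure.continuous_integral_continuousMap F
  obtain ⟨μ₁, hμ₁, hmax⟩ := hPc.exists_isMaxOn ⟨μ₀, hμ₀⟩ hFc.continuousOn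
  set M := ∫ y, F y ∂(μ₁ : Measure Z)
  have hMc : c ≤ M := hc.trans (hmax hμ₀)
  set Q : Set (ProbabilityMeasure Z) := P ∩ {μ | M ≤ ∫ y, F y ∂(μ : Measure Z)}
  have hQ : IsCompact Q := hPc.inter_right (isClosed_le continuous_const hFc)
  -- Probability measures do not form a vector space; embedding them in a product of lines makes the
  -- existence of extreme points of compact sets available.
  let Φ : ProbabilityMeasure Z → C(Z, ℝ) → ℝ := fun μ f => ∫ y, f y ∂(μ : Measure Z)
  have hΦ : Continuous Φ :=
    continuous_pi fun f => ProbabilityMeasure.continuous_integral_continuousMap f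
  have hinj : Function.Injective Φ := fun μ ν hμν => by
    apply ProbabilityMeasure.toMeasure_injective
    apply ext_of_forall_integral_eq_of_IsFiniteMeasure
    exact fun f => congrFun hμν f.toContinuousMap
  obtain ⟨φ, hφ⟩ := (hQ.image hΦ).extremePoints_nonempty ⟨_, μ₁, ⟨hμ₁, le_refl M⟩, rfl⟩
  obtain ⟨⟨μ, hμ, rfl⟩, hext⟩ := hφ
  refine ⟨μ, Ergodic.of_mem_extremePoints ⟨⟨hμ.1, inferInstance⟩, ?_⟩, hMc.trans hμ.2⟩
  rintro ν₁ ⟨hν₁, hν₁'⟩ ν₂ ⟨hν₂, hν₂'⟩ ⟨a, b, ha, hb, hab, habμ⟩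
  have hat : a ≠ ⊤ := fun h => by simp [h] at hab
  have hbt : b ≠ ⊤ := fun h => by simp [h] at hab
  have hab' : a.toReal + b.toReal = 1 := by
    rw [← ENNReal.toReal_add hat hbt, hab, ENNReal.toReal_one]
  have ha' : 0 < a.toReal := ENNReal.toReal_pos ha.ne' hat
  have hb' : 0 < b.toReal := ENNReal.toReal_pos hb.ne' hbt
  have hcomb (f : C(Z, ℝ)) : ∫ y, f y ∂(μ : Measure Z) =
      a.toReal * ∫ y, f y ∂ν₁ + b.toReal * ∫ y, f y ∂ν₂ := by
    rw [← habμ, integral_add_measure, integral_smul_measure, integral_smul_measure]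
    · simp
    · exact (integrable_continuousMap f _).smul_measure hat
    · exact (integrable_continuousMap f _).smul_measure hbt
  let n₁ : ProbabilityMeasure Z := ⟨ν₁, hν₁'⟩
  let n₂ : ProbabilityMeasure Z := ⟨ν₂, hν₂'⟩
  have h1 : ∫ y, F y ∂ν₁ ≤ M := hmax (show n₁ ∈ P from hν₁)
  have h2 : ∫ y, F y ∂ν₂ ≤ M := hmax (show n₂ ∈ P from hν₂)
  have h3 : M ≤ _ := hμ.2
  rw [hcomb F] at h3
  have hM : M = a.toReal * M + b.toReal * M := by rw [← add_mul, hab', one_mul]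
  -- The face property: neither component exceeds `M` and their average is at least `M`, so both
  -- attain it.
  have h4 : M ≤ ∫ y, F y ∂ν₁ := by
    refine le_of_mul_le_mul_left ?_ ha'
    linarith [mul_le_mul_of_nonneg_left h2 hb'.le]
  have h5 : M ≤ ∫ y, F y ∂ν₂ := by
    refine le_of_mul_le_mul_left ?_ hb'
    linarith [mul_le_mul_of_nonneg_left h1 ha'.le]
  have h6 := hext (x₁ := Φ n₁) ⟨n₁, ⟨hν₁, h4⟩, rfl⟩ (x₂ := Φ n₂) ⟨n₂, ⟨hν₂, h5⟩, rfl⟩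
    ⟨a.toReal, b.toReal, ha', hb', hab', funext fun f => (hcomb f).symm⟩
  exact congrArg (fun m : ProbabilityMeasure Z => (m : Measure Z)) (hinj h6)

omit [TopologicalSpace.MetrizableSpace Z] in
theorem integral_birkhoffSum {T : Z → Z} (hT : Continuous T) {μ : ProbabilityMeasure Z}
    (hμ : MeasurePreserving T (μ : Measure Z) μ) (F : C(Z, ℝ)) (N : ℕ) :
    ∫ y, birkhoffSum T F N y ∂(μ : Measure Z) = N * ∫ y, F y ∂(μ : Measure Z) := by
  have hi (n : ℕ) : Integrable (fun y => F (T^[n] y)) (μ : Measure Z) :=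
    integrable_continuousMap (F.comp ⟨_, hT.iterate n⟩) _
  have hn (n : ℕ) : ∫ y, F (T^[n] y) ∂(μ : Measure Z) = ∫ y, F y ∂(μ : Measure Z) := by
    conv_rhs => rw [← (hμ.iterate n).map_eq]
    rw [integral_map (hT.iterate n).measurable.aemeasurable F.continuous.aestronglyMeasurable]
  simp only [birkhoffSum]
  rw [integral_finsetSum _ fun n _ => hi n]
  simp [hn]

omit [TopologicalSpace.MetrizableSpace Z] in
-- The bound extends from `s` to all points by continuity. Integrating it gives `N * ∫ F ≤ c * N +
-- B` for every `N`, and the constant `B` disappears on division by `N`.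
theorem integral_le_of_birkhoffSum_le {T : Z → Z} (hT : Continuous T) {μ : ProbabilityMeasure Z}
    (hμ : MeasurePreserving T (μ : Measure Z) μ) (F : C(Z, ℝ)) {s : Set Z} (hs : Dense s)
    {c B : ℝ} (h : ∀ y ∈ s, ∀ N : ℕ, birkhoffSum T F N y ≤ c * N + B) :
    ∫ y, F y ∂(μ : Measure Z) ≤ c := by
  have hcont (N : ℕ) : Continuous (birkhoffSum T F N) :=
    continuous_finsetSum _ fun n _ => F.continuous.comp (hT.iterate n)
  have hall (N : ℕ) (y : Z) : birkhoffSum T F N y ≤ c * N + B := by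
    have : closure s ⊆ {y | birkhoffSum T F N y ≤ c * N + B} :=
      closure_minimal (fun y hy => h y hy N) (isClosed_le (hcont N) continuous_const)
    exact this (hs y)
  have hint (N : ℕ) : N * ∫ y, F y ∂(μ : Measure Z) ≤ c * N + B := by
    rw [← integral_birkhoffSum hT hμ]
    have := integral_mono (μ := (μ : Measure Z)) (integrable_continuousMap ⟨_, hcont N⟩ _)
      (integrable_const (c * N + B)) (hall N)
    simpa using this
  by_contra! hlt
  obtain ⟨N, hN⟩ := exists_nat_gt (B / (∫ y, F y ∂(μ : Measure Z) - c))
  rw [div_lt_iff₀ (sub_pos.2 hlt)] at hN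
  linarith [hint N]

end Invariant

/-! ### Ergodic measures on an orbit closure -/

section Orbit

variable {Y : Type*} [TopologicalSpace Y] [CompactSpace Y] [TopologicalSpace.MetrizableSpace Y]
  [MeasurableSpace Y] [BorelSpace Y]

/-- On the closure of an orbit there is an ergodic measure which nearly attains the upper Banach
mean of a given continuous function, while all its integrals of continuous functions are bounded by
the upper Banach means along the orbit. -/
theorem exists_ergodic_orbit {G : Type*} [AddMonoidWithOne G] {T : Y → Y} (hT : Continuous T)
    {z : G → Y} (hz : ∀ i, T (z i) = z (i + 1)) (F₀ : C(Y, ℝ)) {c₀ : ℝ}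
    (h : ∀ N : ℕ, ∃ i, c₀ * (N + 1) ≤ birkhoffSum T F₀ (N + 1) (z i)) :
    ∃ μ : ProbabilityMeasure Y, Ergodic T (μ : Measure Y) ∧ c₀ ≤ ∫ y, F₀ y ∂(μ : Measure Y) ∧
      ∀ (F : C(Y, ℝ)) (c B : ℝ), (∀ i, ∀ N : ℕ, birkhoffSum T F N (z i) ≤ c * N + B) →
        ∫ y, F y ∂(μ : Measure Y) ≤ c := by
  -- The orbit closure is treated as a system of its own: the orbit is dense there, so bounds along
  -- it control every invariant measure.
  set Z := closure (range z)
  have : CompactSpace Z := isCompact_iff_compactSpace.1 isClosed_closure.isCompact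
  have hmaps : MapsTo T Z Z := by
    refine MapsTo.closure (fun y hy => ?_) hT
    obtain ⟨i, rfl⟩ := hy
    exact ⟨i + 1, (hz i).symm⟩
  let S : Z → Z := hmaps.restrict
  have hS : Continuous S := hT.restrict hmaps
  let w : G → Z := fun i => ⟨z i, subset_closure ⟨i, rfl⟩⟩
  have hiter (n : ℕ) (y : Z) : ((S^[n] y : Z) : Y) = T^[n] y := by
    have : Function.Semiconj ((↑) : Z → Y) S T := fun _ => rfl
    exact this.iterate_right n y
  have hsum (F : C(Y, ℝ)) (N : ℕ) (y : Z) :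
      birkhoffSum S (F.comp ⟨_, continuous_subtype_val⟩) N y = birkhoffSum T F N (y : Y) := by
    simp [birkhoffSum, hiter]
  have hw : Dense (range w) := by
    intro y
    rw [closure_subtype, ← range_comp]
    exact y.2
  obtain ⟨μ, hμ, hc⟩ := exists_ergodic_of_birkhoffSum_ge hS
    (F₀.comp ⟨((↑) : Z → Y), continuous_subtype_val⟩) (c := c₀) (fun N => by
      obtain ⟨i, hi⟩ := h N
      exact ⟨w i, by rw [hsum]; exact hi⟩)
  have hm : Measurable ((↑) : Z → Y) := measurable_subtype_coe
  have hint (F : C(Y, ℝ)) : ∫ y, F y ∂(μ.map hm.aemeasurable : Measure Y) =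
      ∫ y : Z, F y ∂(μ : Measure Z) := by
    rw [ProbabilityMeasure.toMeasure_map,
      integral_map hm.aemeasurable F.continuous.aestronglyMeasurable]
  refine ⟨μ.map hm.aemeasurable, ?_, ?_, fun F c B hF => ?_⟩
  · exact MeasurePreserving.ergodic_of_ergodic_semiconj ⟨hm, (ProbabilityMeasure.toMeasure_map μ hm.aemeasurable).symm⟩ hμ hT.measurable fun _ => rfl
  · rw [hint]; exact hc
  · rw [hint]
    refine integral_le_of_birkhoffSum_le hS hμ.toMeasurePreserving
      (F.comp ⟨((↑) : Z → Y), continuous_subtype_val⟩) hw (c := c) (B := B) ?_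
    rintro _ ⟨i, rfl⟩ N
    rw [hsum]
    exact hF i N

end Orbit

/-! ### Sums along decompositions; `hG` lets one argument serve both `ℤ` and `ℕ` -/

namespace Decomposition

variable {G : Type*} [CommSemiring G] [LinearOrder G] [IsStrictOrderedRing G]
  (hG : ∀ a b : G, a ≤ b → ∃ n : ℕ, b = a + n) (D : Decomposition G)

include hG in
theorem exists_offset (i : G) : ∃ j, ∃ a < D.length j, i = D.start j + (a : G) := by
  obtain ⟨j, hj⟩ := D.covers i
  obtain ⟨a, ha⟩ := hG _ _ hj.1
  refine ⟨j, a, ?_, ha⟩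
  have := hj.2
  rw [ha] at this
  exact_mod_cast lt_of_add_lt_add_left this

theorem start_add_length_le (j : G) (n : ℕ) :
    D.start j + (D.length j : G) ≤ D.start (j + ((n + 1 : ℕ) : G)) := by
  induction n with
  | zero => simp [D.start_succ]
  | succ n ih =>
    refine ih.trans ?_
    rw [Nat.cast_succ (n + 1), ← add_assoc, D.start_succ]
    exact le_add_of_nonneg_right (Nat.cast_nonneg _)

include hG in
theorem start_add_length_le_of_lt {j j' : G} (h : j < j') :
    D.start j + (D.length j : G) ≤ D.start j' := by
  obtain ⟨n, rfl⟩ := hG _ _ h.le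
  cases n with
  | zero => simp at h
  | succ n => exact D.start_add_length_le j n

include hG in
theorem index_unique {i j j' : G} (h : i ∈ Ico (D.start j) (D.start j + (D.length j : G)))
    (h' : i ∈ Ico (D.start j') (D.start j' + (D.length j' : G))) : j = j' := by
  rcases lt_trichotomy j j' with hlt | rfl | hlt
  · exact absurd (h.2.trans_le ((D.start_add_length_le_of_lt hG hlt).trans h'.1)) (lt_irrefl _)
  · rfl
  · exact absurd (h'.2.trans_le ((D.start_add_length_le_of_lt hG hlt).trans h.1)) (lt_irrefl _)

/-- The index of the block which contains the coordinate `i`. -/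
def index (i : G) : G := (D.covers i).choose

omit [IsStrictOrderedRing G] in
theorem mem_index (i : G) :
    i ∈ Ico (D.start (D.index i)) (D.start (D.index i) + (D.length (D.index i) : G)) :=
  (D.covers i).choose_spec

include hG in
theorem index_start_add {j : G} {a : ℕ} (ha : a < D.length j) :
    D.index (D.start j + (a : G)) = j := by
  refine D.index_unique hG (D.mem_index _) ⟨le_add_of_nonneg_right (Nat.cast_nonneg _), ?_⟩
  gcongr

omit [IsStrictOrderedRing G] in
-- Complete blocks are peeled off from the left, each contributing at most zero; what remains is
-- part of one block, with fewer than `K` terms.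
theorem sum_start_le {K : ℕ} (hK : ∀ j, D.length j ≤ K) {g : G → ℝ} {M : ℝ} (hM : ∀ i, |g i| ≤ M)
    (hg : ∀ j, ∑ n ∈ Finset.range (D.length j), g (D.start j + (n : G)) ≤ 0) (n : ℕ) (j : G) :
    ∑ m ∈ Finset.range n, g (D.start j + (m : G)) ≤ K * M := by
  have hM0 : 0 ≤ M := (abs_nonneg _).trans (hM 0)
  induction n using Nat.strong_induction_on generalizing j with
  | _ n ih =>
    rcases lt_or_ge n (D.length j) with hlt | hle
    · calc _ ≤ ∑ m ∈ Finset.range n, M := Finset.sum_le_sum fun m _ => (le_abs_self _).trans (hM _)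
        _ = n * M := by simp
        _ ≤ K * M := by
          gcongr
          exact hlt.le.trans (hK j)
    · obtain ⟨r, rfl⟩ := Nat.exists_eq_add_of_le hle
      rw [Finset.sum_range_add]
      have h1 := ih r (by have := D.length_pos j; omega) (j + 1)
      rw [D.start_succ] at h1
      simp only [Nat.cast_add, ← add_assoc]
      linarith [hg j]

include hG in
-- After subtracting `c` from `h`, the window is extended left to the start of a block. The added
-- terms and the incomplete last block each cost at most `K * (M + |c|)`.
theorem sum_window_le {K : ℕ} (hK : ∀ j, D.length j ≤ K) {h : G → ℝ} {M c : ℝ}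
    (hM : ∀ i, |h i| ≤ M)
    (hh : ∀ j, ∑ n ∈ Finset.range (D.length j), h (D.start j + (n : G)) ≤ c * D.length j)
    (i : G) (N : ℕ) :
    ∑ n ∈ Finset.range N, h (i + (n : G)) ≤ c * N + 2 * (K * (M + |c|)) := by
  have hg (i : G) : |h i - c| ≤ M + |c| := (abs_sub _ _).trans (by gcongr; exact hM i)
  have hM0 : 0 ≤ M + |c| := (abs_nonneg _).trans (hg 0)
  obtain ⟨j, a, ha, rfl⟩ := D.exists_offset hG i
  have h1 := D.sum_start_le hK hg (fun j => by simpa [mul_comm] using hh j) (a + N) j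
  rw [Finset.sum_range_add] at h1
  have h2 : -(∑ m ∈ Finset.range a, (h (D.start j + (m : G)) - c)) ≤ K * (M + |c|) := by
    rw [← Finset.sum_neg_distrib]
    calc _ ≤ ∑ m ∈ Finset.range a, (M + |c|) :=
          Finset.sum_le_sum fun m _ => (neg_le_abs _).trans (hg _)
      _ = a * (M + |c|) := by simp [mul_add]
      _ ≤ K * (M + |c|) := by
        gcongr
        exact ha.le.trans (hK j)
  have h3 : ∑ m ∈ Finset.range N, (h (D.start j + ((a + m : ℕ) : G)) - c) =
      ∑ n ∈ Finset.range N, h (D.start j + (a : G) + (n : G)) - c * N := by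
    simp [add_assoc, mul_comm]
  linarith

end Decomposition

/-! ### Upper Banach density as window averages -/

section Density

variable {G : Type*} [CommSemiring G] [LinearOrder G] [IsStrictOrderedRing G]
  (hG : ∀ a b : G, a ≤ b → ∃ n : ℕ, b = a + n)

include hG in
theorem ncard_inter_Ico (A : Set G) (i : G) (N : ℕ) :
    ((A ∩ Ico i (i + (N : G))).ncard : ℝ) =
      ∑ n ∈ Finset.range N, A.indicator (1 : G → ℝ) (i + (n : G)) := by
  classical
  have : A ∩ Ico i (i + (N : G)) =
      (((Finset.range N).filter fun n : ℕ => i + (n : G) ∈ A).image fun n : ℕ => i + (n : G) :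
        Finset G) := by
    ext y
    simp only [mem_inter_iff, mem_Ico, Finset.coe_image, Finset.coe_filter, Finset.mem_range,
      mem_image, mem_ofPred_eq]
    constructor
    · rintro ⟨hy, h1, h2⟩
      obtain ⟨n, rfl⟩ := hG _ _ h1
      exact ⟨n, ⟨by exact_mod_cast lt_of_add_lt_add_left h2, hy⟩, rfl⟩
    · rintro ⟨n, ⟨hn, hy⟩, rfl⟩
      exact ⟨hy, le_add_of_nonneg_right (Nat.cast_nonneg _), by gcongr⟩
  rw [this, ncard_coe_finset, Finset.card_image_of_injective]
  · simp [indicator_apply]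
  · exact fun a b hab => by exact_mod_cast add_left_cancel hab

include hG in
theorem exists_window_of_le_upperBanachDensity {A : Set G} {ε c : ℝ}
    (h : ε ≤ upperBanachDensity A) (hc : c < ε) (N : ℕ) :
    ∃ i, c * (N + 1) ≤
      ∑ n ∈ Finset.range (N + 1), A.indicator (1 : G → ℝ) (i + (n : G)) := by
  have h1 : c < ⨆ i : G, ((A ∩ Ico i (i + ((N + 1 : ℕ) : G))).ncard : ℝ) / ((N + 1 : ℕ) : ℝ) := by
    refine hc.trans_le (h.trans (ciInf_le ⟨0, ?_⟩ (⟨N + 1, N.succ_pos⟩ : ℕ+)))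
    rintro _ ⟨M, rfl⟩
    exact Real.iSup_nonneg fun i => by positivity
  obtain ⟨i, hi⟩ := exists_lt_of_lt_ciSup h1
  refine ⟨i, ?_⟩
  rw [← ncard_inter_Ico hG]
  rw [lt_div_iff₀ (by positivity)] at hi
  exact_mod_cast hi.le

end Density

/-! ### Block frequencies as visits to cylinders -/

section Frequency

variable {G Λ : Type*} [AddMonoidWithOne G] [TopologicalSpace Λ]

/-- The point `σ^i x` of the subshift. -/
def Subshift.translate (X : Subshift G Λ) (i : G) (x : X.Pt) : X.Pt :=
  ⟨shift i x.1, X.shift_mem i x.1 x.2⟩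

/-- A word of length `l + 1` fits in a block of length `k` at exactly the first `k - l` positions;
truncated subtraction gives the correct value `0` when the word is too long. -/
theorem freq_blockAt_mul (X : Subshift G Λ) (x : X.Pt) (i : G) (k : ℕ) (hk : 0 < k)
    {l : ℕ} (C : Fin (l + 1) → Λ) :
    freq (X.blockAt x i k hk).toFun C * k = ∑ n ∈ Finset.range (k - l),
      (X.cylinder C).indicator (1 : X.Pt → ℝ) (X.translate (i + (n : G)) x) := by
  classical
  have hset : {n : ℕ | ∃ h : n + (l + 1) ≤ k, ∀ j : Fin (l + 1),
      (X.blockAt x i k hk).toFun ⟨n + j, by change _ < k; omega⟩ = C j} =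
      ((Finset.range (k - l)).filter fun n : ℕ =>
        X.translate (i + (n : G)) x ∈ X.cylinder C : Finset ℕ) := by
    ext n
    simp only [mem_ofPred_eq, Finset.coe_filter, Finset.mem_range, Subshift.cylinder,
      Subshift.translate, shift, Subshift.blockAt, Nat.cast_add, add_assoc]
    constructor
    · rintro ⟨h, h'⟩
      exact ⟨by omega, h'⟩
    · rintro ⟨h, h'⟩
      exact ⟨by omega, h'⟩
  have hk' : (k : ℝ) ≠ 0 := by positivity
  rw [freq]
  change (Set.ncard {n : ℕ | ∃ h : n + (l + 1) ≤ k, ∀ j : Fin (l + 1),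
      (X.blockAt x i k hk).toFun ⟨n + j, by change _ < k; omega⟩ = C j} : ℝ) / k * k = _
  rw [hset, div_mul_cancel₀ _ hk', ncard_coe_finset]
  simp [indicator_apply]

theorem indicator_one_nonneg {α : Type*} (s : Set α) (a : α) : 0 ≤ s.indicator (1 : α → ℝ) a :=
  indicator_nonneg (fun _ _ => zero_le_one) a

theorem indicator_one_le_one {α : Type*} (s : Set α) (a : α) : s.indicator (1 : α → ℝ) a ≤ 1 :=
  indicator_le_self' (fun _ _ => zero_le_one) a

theorem freq_blockAt_mul_le (X : Subshift G Λ) (x : X.Pt) (i : G) (k : ℕ) (hk : 0 < k)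
    {l : ℕ} (C : Fin (l + 1) → Λ) :
    freq (X.blockAt x i k hk).toFun C * k ≤ ∑ n ∈ Finset.range k,
      (X.cylinder C).indicator (1 : X.Pt → ℝ) (X.translate (i + (n : G)) x) := by
  rw [freq_blockAt_mul]
  exact Finset.sum_le_sum_of_subset_of_nonneg (Finset.range_subset_range.2 (Nat.sub_le k l))
    fun _ _ _ => indicator_one_nonneg _ _

theorem le_freq_blockAt_mul_add (X : Subshift G Λ) (x : X.Pt) (i : G) (k : ℕ) (hk : 0 < k)
    {l : ℕ} (C : Fin (l + 1) → Λ) :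
    ∑ n ∈ Finset.range k,
      (X.cylinder C).indicator (1 : X.Pt → ℝ) (X.translate (i + (n : G)) x) ≤
    freq (X.blockAt x i k hk).toFun C * k + l := by
  rw [freq_blockAt_mul]
  have hk : k ≤ k - l + l := by omega
  calc _ ≤ ∑ n ∈ Finset.range (k - l + l),
        (X.cylinder C).indicator (1 : X.Pt → ℝ) (X.translate (i + (n : G)) x) :=
        Finset.sum_le_sum_of_subset_of_nonneg (Finset.range_subset_range.2 hk)
          fun _ _ _ => indicator_one_nonneg _ _
    _ ≤ _ := by
      rw [Finset.sum_range_add]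
      gcongr
      calc _ ≤ ∑ _n ∈ Finset.range l, (1 : ℝ) :=
            Finset.sum_le_sum fun _ _ => indicator_one_le_one _ _
        _ = l := by simp

end Frequency

/-! ### Clopen sets and the marked shift -/

/-- The indicator function of a clopen set as a continuous function. -/
def clopenIndicator {Y : Type*} [TopologicalSpace Y] {s : Set Y} (hs : IsClopen s) : C(Y, ℝ) :=
  ⟨s.indicator 1, by
    rw [← LocallyConstant.coe_charFn ℝ hs]; exact (LocallyConstant.charFn ℝ hs).continuous⟩

theorem integral_clopenIndicator {Y : Type*} [TopologicalSpace Y] [MeasurableSpace Y]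
    [BorelSpace Y] {s : Set Y} (hs : IsClopen s) (μ : Measure Y) :
    ∫ y, clopenIndicator hs y ∂μ = μ.real s :=
  integral_indicator_one hs.2.measurableSet

section Marked

variable {G Λ R : Type*} [AddMonoidWithOne G]
  [TopologicalSpace Λ] {X : Subshift G Λ}

instance Subshift.compactSpace_pt [Finite Λ] : CompactSpace X.Pt :=
  isCompact_iff_compactSpace.1 X.isClosed.isCompact

/-- The shift on the product of a subshift with the full shift over a set of markers. -/
def markedShift (X : Subshift G Λ) (R : Type*) : X.Pt × (G → R) → X.Pt × (G → R) :=
  Prod.map X.σ (shift 1)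

theorem Subshift.continuous_σ (X : Subshift G Λ) : Continuous X.σ :=
  continuous_induced_rng.2
    (continuous_pi fun j => (continuous_apply (1 + j)).comp continuous_subtype_val)

theorem continuous_markedShift [TopologicalSpace R] : Continuous (markedShift X R) :=
  X.continuous_σ.prodMap (continuous_pi fun j => continuous_apply (1 + j))

theorem Subshift.isClopen_cylinder [DiscreteTopology Λ] (X : Subshift G Λ) {l : ℕ}
    (C : Fin l → Λ) : IsClopen (X.cylinder C) := by
  have : X.cylinder C = ⋂ j : Fin l, (fun x : X.Pt => x.1 ((j : ℕ) : G)) ⁻¹' {C j} := by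
    ext x; simp [Subshift.cylinder]
  rw [this]
  exact isClopen_iInter_of_finite fun j =>
    (isClopen_discrete _).preimage ((continuous_apply _).comp continuous_subtype_val)

/-- The set of marked points with the marker `q` at the coordinate `0`. -/
def markSet (X : Subshift G Λ) (q : R) : Set (X.Pt × (G → R)) := {y | y.2 0 = q}

/-- The set of marked points with the marker `q` at the coordinate `0` but not at `1`. -/
def markChangeSet (X : Subshift G Λ) (q : R) : Set (X.Pt × (G → R)) := {y | y.2 0 = q ∧ y.2 1 ≠ q}

variable [TopologicalSpace R] [DiscreteTopology R]

theorem isClopen_mark_mem (i : G) (E : Set R) : IsClopen {y : X.Pt × (G → R) | y.2 i ∈ E} :=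
  (isClopen_discrete E).preimage ((continuous_apply i).comp continuous_snd)

theorem isClopen_markSet (q : R) : IsClopen (markSet X q) := isClopen_mark_mem 0 {q}

theorem isClopen_markChangeSet (q : R) : IsClopen (markChangeSet X q) :=
  (isClopen_mark_mem 0 {q}).inter (isClopen_mark_mem 1 {q}ᶜ)

theorem isClopen_markSet_inter_cylinder [DiscreteTopology Λ] (q : R) {l : ℕ} (C : Fin l → Λ) :
    IsClopen (markSet X q ∩ Prod.fst ⁻¹' X.cylinder C) :=
  (isClopen_markSet q).inter ((X.isClopen_cylinder C).preimage continuous_fst)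

end Marked

/-! ### An ergodic measure that sees the block types -/

section Main

variable {G Λ R : Type*} [CommSemiring G] [LinearOrder G] [IsStrictOrderedRing G] [Countable G]
  [Finite Λ] [TopologicalSpace Λ] [DiscreteTopology Λ] [MeasurableSpace Λ] [BorelSpace Λ]
  [Finite R] [TopologicalSpace R] [DiscreteTopology R] [MeasurableSpace R] [BorelSpace R]
  {X : Subshift G Λ}

/-- If, along decompositions of `x` into blocks of lengths in `[k, K]`, the blocks with types in `E`
have upper Banach density greater than `c`, then the types of the blocks are seen by an ergodic
measure on the product of `X` with a full shift. -/
theorem exists_ergodic_marked (hG : ∀ a b : G, a ≤ b → ∃ n : ℕ, b = a + n)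
    (τ : X.Block → R) (E : Set R) {ε c : ℝ} (hc : c < ε) (x : X.Pt) (D : Decomposition G)
    {k K : ℕ} (hk : 0 < k) (hkD : ∀ j, k ≤ D.length j) (hKD : ∀ j, D.length j ≤ K)
    (hdens : ε ≤ upperBanachDensity {i : G | ∃ j : G,
      i ∈ Ico (D.start j) (D.start j + (D.length j : G)) ∧ τ (D.block X x j) ∈ E}) :
    ∃ μ : ProbabilityMeasure (X.Pt × (G → R)),
      Ergodic (markedShift X R) (μ : Measure (X.Pt × (G → R))) ∧
      c ≤ (μ : Measure (X.Pt × (G → R))).real {y | y.2 0 ∈ E} ∧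
      (∀ q, (μ : Measure (X.Pt × (G → R))).real (markChangeSet X q) ≤ 1 / k) ∧
      ∀ (q : R) (l : ℕ) (C : Fin (l + 1) → Λ) (a : ℝ),
        ((∀ B : X.Block, τ B = q → freq B.toFun C ≤ a) →
          (μ : Measure (X.Pt × (G → R))).real (markSet X q ∩ Prod.fst ⁻¹' X.cylinder C) ≤
            a * (μ : Measure (X.Pt × (G → R))).real (markSet X q) + l / k) ∧
        ((∀ B : X.Block, τ B = q → a ≤ freq B.toFun C) →
          a * (μ : Measure (X.Pt × (G → R))).real (markSet X q) ≤
          (μ : Measure (X.Pt × (G → R))).real (markSet X q ∩ Prod.fst ⁻¹' X.cylinder C)) := by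
  classical
  have : TopologicalSpace.MetrizableSpace (X.Pt × (G → R)) :=
    TopologicalSpace.metrizableSpace_of_t3_secondCountable _
  set T := markedShift X R
  have hT : Continuous T := continuous_markedShift
  -- Each coordinate carries the type of the block containing it.
  let m : G → R := fun i => τ (D.block X x (D.index i))
  have hm (j : G) (n : ℕ) (hn : n < D.length j) :
      m (D.start j + (n : G)) = τ (D.block X x j) := by
    simp only [m, D.index_start_add hG hn]
  let z : G → X.Pt × (G → R) := fun i => (X.translate i x, shift i m)
  have hz (i : G) : T (z i) = z (i + 1) := by
    refine Prod.ext (Subtype.ext (funext fun j => ?_)) (funext fun j => ?_)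
    · change x.1 (i + (1 + j)) = x.1 (i + 1 + j)
      rw [add_assoc]
    · change m (i + (1 + j)) = m (i + 1 + j)
      rw [add_assoc]
  have hz0 (i : G) : (z i).2 0 = m i := congrArg m (add_zero i)
  have hiter (i : G) (n : ℕ) : T^[n] (z i) = z (i + (n : G)) := by
    induction n with
    | zero => simp
    | succ n ih => rw [Function.iterate_succ_apply', ih, hz, add_assoc, Nat.cast_succ]
  have hsum (F : X.Pt × (G → R) → ℝ) (N : ℕ) (i : G) :
      birkhoffSum T F N (z i) = ∑ n ∈ Finset.range N, F (z (i + (n : G))) := by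
    simp [birkhoffSum, hiter]
  obtain ⟨μ, hμ, hμc, hμF⟩ := exists_ergodic_orbit hT hz
    (clopenIndicator (isClopen_mark_mem (X := X) 0 E)) (c₀ := c) (fun N => by
      obtain ⟨i, hi⟩ := exists_window_of_le_upperBanachDensity hG hdens hc N
      refine ⟨i, hi.trans_eq ?_⟩
      rw [hsum]
      refine Finset.sum_congr rfl fun n _ => ?_
      have : (i + (n : G) ∈ {i : G | ∃ j : G, i ∈ Ico (D.start j) (D.start j + (D.length j : G)) ∧
          τ (D.block X x j) ∈ E}) ↔ z (i + (n : G)) ∈ {y : X.Pt × (G → R) | y.2 0 ∈ E} := by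
        simp only [mem_ofPred_eq, hz0, m]
        constructor
        · rintro ⟨j, hj, hjE⟩
          rwa [← D.index_unique hG hj (D.mem_index _)]
        · exact fun h => ⟨_, D.mem_index _, h⟩
      simp only [clopenIndicator, ContinuousMap.coe_mk, indicator_apply, this, Pi.one_apply])
  -- The main device below: an upper bound on the average of `F` over every single block bounds its
  -- integral.
  have hblock (F : C(X.Pt × (G → R), ℝ)) (a : ℝ) (hF : ∀ j,
      ∑ n ∈ Finset.range (D.length j), F (z (D.start j + (n : G))) ≤ a * D.length j) :
      ∫ y, F y ∂(μ : Measure (X.Pt × (G → R))) ≤ a :=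
    hμF F a _ fun i N => by
      rw [hsum]
      exact D.sum_window_le hG hKD (h := fun i => F (z i)) (fun i => F.norm_coe_le_norm _) hF i N
  rw [integral_clopenIndicator] at hμc
  have hmark (q : R) (j : G) (n : ℕ) (hn : n < D.length j) :
      z (D.start j + (n : G)) ∈ markSet X q ↔ τ (D.block X x j) = q := by
    rw [← hm j n hn]
    exact (hz0 _).congr_left
  have hsum_mark (q : R) (j : G) :
      ∑ n ∈ Finset.range (D.length j),
        clopenIndicator (isClopen_markSet (X := X) q) (z (D.start j + (n : G))) =
      if τ (D.block X x j) = q then (D.length j : ℝ) else 0 := by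
    rw [Finset.sum_congr rfl fun (n : ℕ) (hn : n ∈ Finset.range (D.length j)) => show clopenIndicator (isClopen_markSet (X := X) q)
      (z (D.start j + (n : G))) = if τ (D.block X x j) = q then (1 : ℝ) else 0 by
        simp [clopenIndicator, indicator_apply, hmark q j n (Finset.mem_range.1 hn)]]
    split_ifs <;> simp
  have hsum_cyl (q : R) (l : ℕ) (C : Fin (l + 1) → Λ) (j : G) :
      ∑ n ∈ Finset.range (D.length j),
        clopenIndicator (isClopen_markSet_inter_cylinder (X := X) q C) (z (D.start j + (n : G))) =
      if τ (D.block X x j) = q then ∑ n ∈ Finset.range (D.length j),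
        (X.cylinder C).indicator (1 : X.Pt → ℝ) (X.translate (D.start j + (n : G)) x) else 0 := by
    rw [Finset.sum_congr rfl fun (n : ℕ) (hn : n ∈ Finset.range (D.length j)) => show
      clopenIndicator (isClopen_markSet_inter_cylinder (X := X) q C)
      (z (D.start j + (n : G))) = if τ (D.block X x j) = q then
        (X.cylinder C).indicator (1 : X.Pt → ℝ) (X.translate (D.start j + (n : G)) x) else 0 by
        simp only [clopenIndicator, ContinuousMap.coe_mk, indicator_apply, mem_inter_iff,
          hmark q j n (Finset.mem_range.1 hn), mem_preimage, Pi.one_apply, ite_and]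
        rfl]
    split_ifs <;> simp
  have hlen (j : G) : (1 : ℝ) ≤ 1 / k * D.length j := by
    rw [one_div, inv_mul_eq_div, one_le_div (by positivity)]
    exact_mod_cast hkD j
  have hint (F : C(X.Pt × (G → R), ℝ)) : Integrable F (μ : Measure (X.Pt × (G → R))) :=
    integrable_continuousMap F _
  refine ⟨μ, hμ, hμc, fun q => ?_, fun q l C a => ⟨fun ha => ?_, fun ha => ?_⟩⟩
  -- The marker can change only after the last coordinate of a block, hence at most once per block
  -- of length at least `k`.
  · rw [← integral_clopenIndicator (isClopen_markChangeSet q)]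
    refine hblock _ _ fun j => (hlen j).trans' ?_
    obtain ⟨n, hn⟩ := Nat.exists_eq_succ_of_ne_zero (D.length_pos j).ne'
    rw [hn, Finset.sum_range_succ, Finset.sum_eq_zero, zero_add]
    · exact indicator_one_le_one _ _
    · intro i hi
      rw [Finset.mem_range] at hi
      refine indicator_of_notMem (fun h => h.2 ?_) _
      have h1 : τ (D.block X x j) = q := (hmark q j i (by omega)).1 h.1
      rw [← h1, ← hm j (i + 1) (by omega), Nat.cast_succ, ← add_assoc, ← hz0, ← hz]
      exact congrArg m (by simp only [add_assoc, add_zero])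
  -- Occurrences running over the end of a block are not counted by `freq`; there are at most `l`
  -- per block, which costs `l / k`.
  · have := hblock (clopenIndicator (isClopen_markSet_inter_cylinder q C) -
      a • clopenIndicator (isClopen_markSet q)) (l / k) fun j => by
        simp only [ContinuousMap.sub_apply, ContinuousMap.smul_apply, smul_eq_mul,
          Finset.sum_sub_distrib, ← Finset.mul_sum, hsum_mark, hsum_cyl]
        split_ifs with h
        · have h1 := le_freq_blockAt_mul_add X x (D.start j) (D.length j) (D.length_pos j) C
          have h2 := mul_le_mul_of_nonneg_right (ha _ h) (Nat.cast_nonneg (α := ℝ) (D.length j))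
          have h3 := mul_le_mul_of_nonneg_left (hlen j) (Nat.cast_nonneg (α := ℝ) l)
          have h4 : (l : ℝ) * (1 / k * D.length j) = l / k * D.length j := by ring
          change freq (X.blockAt x (D.start j) (D.length j) (D.length_pos j)).toFun C *
            (D.length j : ℝ) ≤ _ at h2
          linarith
        · simp; positivity
    simp only [ContinuousMap.sub_apply, ContinuousMap.smul_apply, smul_eq_mul] at this
    rw [integral_sub (hint _) ((hint _).const_mul a), integral_const_mul,
      integral_clopenIndicator, integral_clopenIndicator] at this
    linarith
  -- In this direction no error arises: occurrences running over the end only increase the cylinder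
  -- count.
  · have := hblock (a • clopenIndicator (isClopen_markSet q) -
      clopenIndicator (isClopen_markSet_inter_cylinder q C)) 0 fun j => by
        simp only [ContinuousMap.sub_apply, ContinuousMap.smul_apply, smul_eq_mul,
          Finset.sum_sub_distrib, ← Finset.mul_sum, hsum_mark, hsum_cyl]
        split_ifs with h
        · have h1 := freq_blockAt_mul_le X x (D.start j) (D.length j) (D.length_pos j) C
          have h2 := mul_le_mul_of_nonneg_right (ha _ h) (Nat.cast_nonneg (α := ℝ) (D.length j))
          change _ ≤ freq (X.blockAt x (D.start j) (D.length j) (D.length_pos j)).toFun C *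
            (D.length j : ℝ) at h2
          linarith
        · simp
    simp only [ContinuousMap.sub_apply, ContinuousMap.smul_apply, smul_eq_mul] at this
    rw [integral_sub ((hint _).const_mul a) (hint _), integral_const_mul,
      integral_clopenIndicator, integral_clopenIndicator] at this
    linarith

end Main

/-! ### The limit of the marked measures -/

theorem continuous_real_of_isClopen {Y : Type*} [TopologicalSpace Y] [CompactSpace Y]
    [MeasurableSpace Y] [BorelSpace Y] {s : Set Y} (hs : IsClopen s) :
    Continuous fun μ : ProbabilityMeasure Y => (μ : Measure Y).real s := by
  simpa only [integral_clopenIndicator] using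
    ProbabilityMeasure.continuous_integral_continuousMap (clopenIndicator hs)

section Limit

variable {G Λ R : Type*} [AddMonoidWithOne G] [Countable G]
  [Finite Λ] [TopologicalSpace Λ] [DiscreteTopology Λ] [MeasurableSpace Λ] [BorelSpace Λ]
  [Finite R] [TopologicalSpace R] [DiscreteTopology R] [MeasurableSpace R] [BorelSpace R]
  {X : Subshift G Λ}

/-- Conditioning an invariant measure with ergodic projection on an invariant marker does not change
its projection. -/
theorem real_projection_eq_of_markChangeSet_null {μ : ProbabilityMeasure (X.Pt × (G → R))}
    (hμ : MeasurePreserving (markedShift X R) (μ : Measure (X.Pt × (G → R))) μ)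
    (hν : Ergodic X.σ ((μ : Measure (X.Pt × (G → R))).map Prod.fst)) {q : R}
    (hq : (μ : Measure (X.Pt × (G → R))).real (markChangeSet X q) = 0)
    (hpos : (μ : Measure (X.Pt × (G → R))).real (markSet X q) ≠ 0) {s : Set X.Pt}
    (hs : MeasurableSet s) :
    ((μ : Measure (X.Pt × (G → R))).map Prod.fst).real s *
        (μ : Measure (X.Pt × (G → R))).real (markSet X q) =
      (μ : Measure (X.Pt × (G → R))).real (markSet X q ∩ Prod.fst ⁻¹' s) := by
  set m := (μ : Measure (X.Pt × (G → R)))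
  set S := markSet X q
  set T := markedShift X R
  have hS : MeasurableSet S := (isClopen_markSet q).2.measurableSet
  have hpos' : m S ≠ 0 := fun h => hpos (by simp [Measure.real, h])
  have hsub : S ≤ᵐ[m] T ⁻¹' S := by
    rw [ae_le_set]
    rw [measureReal_eq_zero_iff] at hq
    refine measure_mono_null (show S \ T ⁻¹' S ⊆ markChangeSet X q from
      fun y hy => ⟨hy.1, fun h => hy.2 ?_⟩) hq
    change y.2 (1 + 0) = q
    rwa [add_zero]
  -- By invariance both sets have the same finite measure, so inclusion almost everywhere is already
  -- equality.
  have hae : S =ᵐ[m] T ⁻¹' S :=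
    ae_eq_of_ae_subset_of_measure_ge hsub (hμ.measure_preimage hS.nullMeasurableSet).le
      hS.nullMeasurableSet (measure_ne_top _ _)
  have hcond : MeasurePreserving T (ProbabilityTheory.cond m S) (ProbabilityTheory.cond m S) := by
    have h := hμ.restrict_preimage hS
    rw [← Measure.restrict_congr_set hae] at h
    exact h.smul_measure _
  have := ProbabilityTheory.cond_isProbabilityMeasure hpos'
  have hfst : Measurable (Prod.fst : X.Pt × (G → R) → X.Pt) := measurable_fst
  have hinv : MeasurePreserving X.σ ((ProbabilityTheory.cond m S).map Prod.fst)
      ((ProbabilityTheory.cond m S).map Prod.fst) :=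
    MeasurePreserving.of_semiconj ⟨hfst, rfl⟩ hcond (fun _ => rfl) X.continuous_σ.measurable
  have := Measure.isProbabilityMeasure_map (μ := ProbabilityTheory.cond m S) hfst.aemeasurable
  have := Measure.isProbabilityMeasure_map (μ := m) hfst.aemeasurable
  -- An ergodic measure is the only invariant probability measure absolutely continuous with respect
  -- to itself.
  have heq := hν.eq_of_absolutelyContinuous hinv
    (ProbabilityTheory.cond_absolutelyContinuous.map hfst)
  rw [← heq, map_measureReal_apply hfst hs, Measure.real, ProbabilityTheory.cond_apply hS,
    ENNReal.toReal_mul, ENNReal.toReal_inv]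
  change (m.real S)⁻¹ * m.real (S ∩ Prod.fst ⁻¹' s) * m.real S = _
  field_simp

/-- If there are ergodic measures on the marked system for which the type-`q` blocks get longer and
longer, then the frequencies in the blocks of some type control some ergodic measure on `X`. -/
theorem exists_ergodic_of_marked (hX : X.IsBauer) (τ : X.Block → R) (E : Set R) {c : ℝ}
    (hc : 0 < c)
    (h : ∀ k : ℕ, ∃ μ : ProbabilityMeasure (X.Pt × (G → R)),
      Ergodic (markedShift X R) (μ : Measure (X.Pt × (G → R))) ∧
      c ≤ (μ : Measure (X.Pt × (G → R))).real {y | y.2 0 ∈ E} ∧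
      (∀ q, (μ : Measure (X.Pt × (G → R))).real (markChangeSet X q) ≤ 1 / ((k + 1 : ℕ) : ℝ)) ∧
      ∀ (q : R) (l : ℕ) (C : Fin (l + 1) → Λ) (a : ℝ),
        ((∀ B : X.Block, τ B = q → freq B.toFun C ≤ a) →
          (μ : Measure (X.Pt × (G → R))).real (markSet X q ∩ Prod.fst ⁻¹' X.cylinder C) ≤
            a * (μ : Measure (X.Pt × (G → R))).real (markSet X q) + l / ((k + 1 : ℕ) : ℝ)) ∧
        ((∀ B : X.Block, τ B = q → a ≤ freq B.toFun C) →
          a * (μ : Measure (X.Pt × (G → R))).real (markSet X q) ≤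
          (μ : Measure (X.Pt × (G → R))).real (markSet X q ∩ Prod.fst ⁻¹' X.cylinder C))) :
    ∃ q ∈ E, ∃ ν ∈ X.ergodicMeasures, ∀ (l : ℕ) (C : Fin (l + 1) → Λ) (a : ℝ),
      ((∀ B : X.Block, τ B = q → freq B.toFun C ≤ a) →
        (ν : Measure X.Pt).real (X.cylinder C) ≤ a) ∧
      ((∀ B : X.Block, τ B = q → a ≤ freq B.toFun C) →
        a ≤ (ν : Measure X.Pt).real (X.cylinder C)) := by
  have : TopologicalSpace.MetrizableSpace (X.Pt × (G → R)) :=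
    TopologicalSpace.metrizableSpace_of_t3_secondCountable _
  choose μs herg hE hchange hfreq using h
  obtain ⟨μ, -, hμ⟩ := isCompact_univ.ultrafilter_le_nhds
    ((hyperfilter ℕ : Ultrafilter ℕ).map μs) (by simp)
  replace hμ : Tendsto μs (hyperfilter ℕ) (𝓝 μ) := hμ
  have hle : (hyperfilter ℕ : Filter ℕ) ≤ atTop := Nat.hyperfilter_le_atTop
  have hdiv (b : ℝ) : Tendsto (fun k : ℕ => b / ((k + 1 : ℕ) : ℝ)) (hyperfilter ℕ) (𝓝 0) :=
    ((tendsto_add_atTop_iff_nat 1).2 (tendsto_const_div_atTop_nhds_zero_nat b)).mono_left hle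
  have hlim {s : Set (X.Pt × (G → R))} (hs : IsClopen s) :
      Tendsto (fun k => (μs k : Measure (X.Pt × (G → R))).real s) (hyperfilter ℕ)
        (𝓝 ((μ : Measure (X.Pt × (G → R))).real s)) :=
    ((continuous_real_of_isClopen hs).tendsto μ).comp hμ
  have hinv : MeasurePreserving (markedShift X R) (μ : Measure (X.Pt × (G → R))) μ :=
    (isClosed_setOf_measurePreserving continuous_markedShift).mem_of_tendsto hμ
      (Eventually.of_forall fun k => (herg k).toMeasurePreserving)
  have hfst : Measurable (Prod.fst : X.Pt × (G → R) → X.Pt) := measurable_fst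
  -- The Bauer hypothesis enters here: projections of ergodic measures are ergodic, and a limit of
  -- such projections stays ergodic.
  have hν : μ.map hfst.aemeasurable ∈ X.ergodicMeasures := by
    have h1 := ((ProbabilityMeasure.continuous_map
      (continuous_fst : Continuous (Prod.fst : X.Pt × (G → R) → X.Pt))).tendsto μ).comp hμ
    refine IsClosed.mem_of_tendsto hX h1 (Eventually.of_forall fun k => ?_)
    exact MeasurePreserving.ergodic_of_ergodic_semiconj
      ⟨hfst, (ProbabilityMeasure.toMeasure_map (μs k) hfst.aemeasurable).symm⟩ (herg k) X.continuous_σ.measurable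
      fun _ => rfl
  have hcE : c ≤ (μ : Measure (X.Pt × (G → R))).real {y | y.2 0 ∈ E} :=
    ge_of_tendsto (hlim (isClopen_mark_mem 0 E)) (Eventually.of_forall hE)
  -- There are finitely many markers, so one in `E` keeps positive mass in the limit.
  obtain ⟨q, hqE, hq⟩ : ∃ q ∈ E, (μ : Measure (X.Pt × (G → R))).real (markSet X q) ≠ 0 := by
    by_contra! hall
    have : {y : X.Pt × (G → R) | y.2 0 ∈ E} = ⋃ q ∈ E, markSet X q := by
      ext y; simp [markSet]
    rw [this] at hcE
    have h0 : (μ : Measure (X.Pt × (G → R))) (⋃ q ∈ E, markSet X q) = 0 := by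
      rw [measure_biUnion_null_iff E.to_countable]
      exact fun q hq => (measureReal_eq_zero_iff).1 (hall q hq)
    rw [Measure.real, h0] at hcE
    simp at hcE
    linarith
  have hq0 : 0 < (μ : Measure (X.Pt × (G → R))).real (markSet X q) :=
    measureReal_nonneg.lt_of_ne' hq
  have hchange0 : (μ : Measure (X.Pt × (G → R))).real (markChangeSet X q) = 0 :=
    le_antisymm (le_of_tendsto_of_tendsto' (hlim (isClopen_markChangeSet q)) (hdiv 1)
      fun k => hchange k q) measureReal_nonneg
  refine ⟨q, hqE, _, hν, fun l C a => ?_⟩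
  have heq := real_projection_eq_of_markChangeSet_null hinv
    (by simpa [Subshift.ergodicMeasures] using hν) hchange0 hq
    (X.isClopen_cylinder C).2.measurableSet
  rw [ProbabilityMeasure.toMeasure_map]
  have hl := hlim (isClopen_markSet_inter_cylinder (X := X) q C)
  have hm := (hlim (isClopen_markSet (X := X) q)).const_mul a
  refine ⟨fun ha => le_of_mul_le_mul_right ?_ hq0, fun ha => le_of_mul_le_mul_right ?_ hq0⟩
  · rw [heq]
    have := le_of_tendsto_of_tendsto' hl (hm.add (hdiv l)) fun k => (hfreq k q l C a).1 ha
    rwa [add_zero] at this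
  · rw [heq]
    exact le_of_tendsto_of_tendsto' hm hl fun k => (hfreq k q l C a).2 ha

end Limit

/-! ### The distance is controlled by finitely many words -/

theorem freq_le_one [Fintype Λ] {k l : ℕ} (B : Fin k → Λ) (C : Fin (l + 1) → Λ) :
    freq B C ≤ 1 :=
  (Finset.single_le_sum (f := fun C => freq B C) (fun C _ => Subshift.freq_nonneg B C)
    (Finset.mem_univ C)).trans (Subshift.sum_freq_le_one B)

theorem abs_sub_le_of_floor_eq {M : ℕ} {a b : ℝ} (ha : 0 ≤ a) (hb : 0 ≤ b)
    (h : ⌊(M + 1 : ℝ) * a⌋₊ = ⌊(M + 1 : ℝ) * b⌋₊) : |a - b| ≤ 1 / ((M : ℝ) + 1) := by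
  have hM : (0 : ℝ) < M + 1 := by positivity
  have h1 := Nat.floor_le (mul_nonneg hM.le ha)
  have h2 := Nat.lt_floor_add_one ((M + 1 : ℝ) * a)
  have h3 := Nat.floor_le (mul_nonneg hM.le hb)
  have h4 := Nat.lt_floor_add_one ((M + 1 : ℝ) * b)
  rw [h] at h1 h2
  rw [abs_le, ← neg_div, div_le_iff₀ hM, le_div_iff₀ hM]
  constructor <;> linarith

section Distance

variable {G Λ : Type*} [AddMonoidWithOne G] [TopologicalSpace Λ] [MeasurableSpace Λ]
  [MeasurableSingletonClass Λ] [Fintype Λ] {X : Subshift G Λ}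

/-- Words of one fixed length have total weight at most `1` under `p` and under `q`, so the levels
from `L` on are dominated by a geometric series with sum `2 * (1 / 2) ^ L`. -/
theorem dist_le_of_weight_close (p q : X.BlockOrMeasure) (L : ℕ) {δ : ℝ}
    (h : ∀ l < L, ∀ C : Fin (l + 1) → Λ, |p.weight C - q.weight C| ≤ δ) :
    dist p q ≤ δ * ∑ l ∈ Finset.range L, (Fintype.card (Fin (l + 1) → Λ) : ℝ) +
      (1 / 2) ^ L * 2 := by
  have hs := Subshift.summable_dStar p q
  change ∑' l : ℕ, (1 / 2 : ℝ) ^ (l + 1) * ∑ C : Fin (l + 1) → Λ, |p.weight C - q.weight C| ≤ _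
  rw [← hs.sum_add_tsum_nat_add L, Finset.mul_sum]
  refine add_le_add (Finset.sum_le_sum fun l hl => ?_) ?_
  · have hsum : ∑ C : Fin (l + 1) → Λ, |p.weight C - q.weight C| ≤
        δ * (Fintype.card (Fin (l + 1) → Λ) : ℝ) := by
      calc _ ≤ ∑ _C : Fin (l + 1) → Λ, δ :=
            Finset.sum_le_sum fun C _ => h l (Finset.mem_range.1 hl) C
        _ = _ := by rw [Finset.sum_const, Finset.card_univ, nsmul_eq_mul, mul_comm]
    refine (mul_le_of_le_one_left (Finset.sum_nonneg fun _ _ => abs_nonneg _) ?_).trans hsum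
    exact pow_le_one₀ (by norm_num) (by norm_num)
  · rw [show (1 / 2 : ℝ) ^ L * 2 = ∑' n : ℕ, (1 / 2 : ℝ) ^ L * (1 / 2) ^ n by
      rw [tsum_mul_left, tsum_geometric_two]]
    refine ((summable_nat_add_iff L).2 hs).tsum_le_tsum (fun l => ?_)
      (summable_geometric_two.mul_left _)
    have h2 : ∑ C : Fin (l + L + 1) → Λ, |p.weight C - q.weight C| ≤ 2 := by
      calc _ ≤ ∑ C : Fin (l + L + 1) → Λ, (p.weight C + q.weight C) := by
            refine Finset.sum_le_sum fun C _ => (abs_sub _ _).trans_eq ?_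
            rw [abs_of_nonneg (Subshift.weight_nonneg C p),
              abs_of_nonneg (Subshift.weight_nonneg C q)]
        _ ≤ 2 := by
            rw [Finset.sum_add_distrib]
            linarith [Subshift.sum_weight_le_one (l := l + L) p,
              Subshift.sum_weight_le_one (l := l + L) q]
    calc _ ≤ (1 / 2 : ℝ) ^ (l + L + 1) * 2 := by gcongr
      _ = (1 / 2) ^ L * (1 / 2) ^ l := by ring

theorem exists_weight_close_imp_dist_lt (X : Subshift G Λ) {δ : ℝ} (hδ : 0 < δ) :
    ∃ L M : ℕ, ∀ p q : X.BlockOrMeasure,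
      (∀ l < L, ∀ C : Fin (l + 1) → Λ, |p.weight C - q.weight C| ≤ 1 / ((M : ℝ) + 1)) →
      dist p q < δ := by
  -- The tail is twice this power, so `δ / 4` leaves `δ / 2` for the first `L` levels.
  obtain ⟨L, hL⟩ := exists_pow_lt_of_lt_one (show 0 < δ / 4 by positivity)
    (show (1 / 2 : ℝ) < 1 by norm_num)
  set S := ∑ l ∈ Finset.range L, (Fintype.card (Fin (l + 1) → Λ) : ℝ)
  have hS : 0 ≤ S := Finset.sum_nonneg fun _ _ => Nat.cast_nonneg _
  obtain ⟨M, hM⟩ := exists_nat_gt (S / (δ / 2))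
  refine ⟨L, M, fun p q h => (dist_le_of_weight_close p q L h).trans_lt ?_⟩
  rw [div_lt_iff₀ (by positivity)] at hM
  have : 1 / ((M : ℝ) + 1) * S < δ / 2 := by
    rw [one_div, inv_mul_eq_div, div_lt_iff₀ (by positivity)]
    linarith
  linarith

/-- Up to a small error the distance involves finitely many cylinders; these are clopen, so their
measures are weak-star continuous. -/
theorem continuous_measure [DiscreteTopology Λ] [Countable G] [BorelSpace Λ] :
    Continuous (Subshift.BlockOrMeasure.measure : ProbabilityMeasure X.Pt → _) := by
  rw [continuous_iff_continuousAt]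
  intro μ
  rw [ContinuousAt, Metric.tendsto_nhds]
  intro δ hδ
  obtain ⟨L, M, h⟩ := exists_weight_close_imp_dist_lt X hδ
  have hev : ∀ᶠ ν : ProbabilityMeasure X.Pt in 𝓝 μ, ∀ l ∈ Finset.range L, ∀ C : Fin (l + 1) → Λ,
      dist ((ν : Measure X.Pt).real (X.cylinder C)) ((μ : Measure X.Pt).real (X.cylinder C)) <
        1 / ((M : ℝ) + 1) := by
    rw [Filter.eventually_all_finset]
    refine fun l _ => eventually_all.2 fun C => ?_
    exact Metric.tendsto_nhds.1 ((continuous_real_of_isClopen (X.isClopen_cylinder C)).tendsto μ)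
      _ (by positivity)
  filter_upwards [hev] with ν hν
  exact h _ _ fun l hl C => (hν l (Finset.mem_range.2 hl) C).le

end Distance

/-! ### Block types and the contradiction -/

section Types

variable {G Λ : Type*} [CommSemiring G] [LinearOrder G] [IsStrictOrderedRing G] [Countable G]
  [TopologicalSpace Λ] [DiscreteTopology Λ] [MeasurableSpace Λ] [BorelSpace Λ]
  {X : Subshift G Λ}

/-- If blocks with types in `E` occupy a set of upper Banach density at least `ε` in decompositions
into arbitrarily long blocks, then the frequencies in the blocks of some type in `E` control some
ergodic measure. -/
theorem exists_ergodic_of_dense_types [Finite Λ] (hG : ∀ a b : G, a ≤ b → ∃ n : ℕ, b = a + n)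
    (hX : X.IsBauer) {R : Type*} [Finite R] (τ : X.Block → R) (E : Set R) {ε : ℝ} (hε : 0 < ε)
    (h : ∀ k : ℕ, ∃ (x : X.Pt) (D : Decomposition G), (∀ j, k ≤ D.length j) ∧
      (∃ K : ℕ, ∀ j, D.length j ≤ K) ∧ ε ≤ upperBanachDensity {i : G | ∃ j : G,
        i ∈ Ico (D.start j) (D.start j + (D.length j : G)) ∧ τ (D.block X x j) ∈ E}) :
    ∃ q ∈ E, ∃ ν ∈ X.ergodicMeasures, ∀ (l : ℕ) (C : Fin (l + 1) → Λ) (a : ℝ),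
      ((∀ B : X.Block, τ B = q → freq B.toFun C ≤ a) →
        (ν : Measure X.Pt).real (X.cylinder C) ≤ a) ∧
      ((∀ B : X.Block, τ B = q → a ≤ freq B.toFun C) →
        a ≤ (ν : Measure X.Pt).real (X.cylinder C)) := by
  let _ : TopologicalSpace R := ⊥
  have : DiscreteTopology R := ⟨rfl⟩
  let _ : MeasurableSpace R := ⊤
  refine exists_ergodic_of_marked hX τ E (half_pos hε) fun k => ?_
  obtain ⟨x, D, hk, ⟨K, hK⟩, hd⟩ := h (k + 1)
  exact exists_ergodic_marked hG τ E (half_lt_self hε) x D k.succ_pos hk hK hd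

/-- **Ergodicity of long blocks over Bauer simplices.** -/
theorem exists_length_upperBanachDensity_nonergodicCoords_lt [Fintype Λ]
    (hG : ∀ a b : G, a ≤ b → ∃ n : ℕ, b = a + n) (hX : X.IsBauer)
    {U : Set X.BlockOrMeasure} (hU : IsOpen U)
    (hUerg : ∀ μ ∈ X.ergodicMeasures, Subshift.BlockOrMeasure.measure μ ∈ U)
    {ε : ℝ} (hε : 0 < ε) :
    ∃ k₀ : ℕ, ∀ (x : X.Pt) (D : Decomposition G),
      (∀ j, k₀ ≤ D.length j) → (∃ K : ℕ, ∀ j, D.length j ≤ K) →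
      upperBanachDensity (D.nonergodicCoords X U x) < ε := by
  by_contra! hcon
  -- Compactness yields a single `δ` such that `U` contains the `δ`-neighbourhood of every ergodic
  -- measure.
  have hcomp : IsCompact (Subshift.BlockOrMeasure.measure '' X.ergodicMeasures) :=
    (IsClosed.isCompact hX).image continuous_measure
  obtain ⟨δ, hδ, hthick⟩ := hcomp.exists_thickening_subset_open hU (image_subset_iff.2 hUerg)
  obtain ⟨L, M, hclose⟩ := exists_weight_close_imp_dist_lt X hδ
  have hfl (B : X.Block) (i : (l : Fin L) × (Fin (l + 1) → Λ)) :
      ⌊(M + 1 : ℝ) * freq B.toFun i.2⌋₊ < M + 2 := by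
    rw [Nat.floor_lt (mul_nonneg (by positivity) (Subshift.freq_nonneg _ _))]
    have := mul_le_mul_of_nonneg_left (freq_le_one B.toFun i.2) (show (0 : ℝ) ≤ M + 1 by positivity)
    push_cast
    linarith
  -- Equal types force frequencies within `1 / (M + 1)` of each other. Frequencies are at most `1`,
  -- so the floors lie in `{0, …, M + 1}`, which makes `M + 2` values.
  let τ : X.Block → Prop × ((l : Fin L) × (Fin (l + 1) → Λ) → Fin (M + 2)) := fun B =>
    (Subshift.BlockOrMeasure.block B ∈ U, fun i => ⟨_, hfl B i⟩)
  obtain ⟨q, hq, ν, hν, hfreq⟩ := exists_ergodic_of_dense_types hG hX τ {r | ¬ r.1} hε hcon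
  obtain ⟨B, hB⟩ : ∃ B, τ B = q := by
    by_contra! hno
    obtain ⟨x⟩ : Nonempty X.Pt := ν.nonempty
    -- Were no block of type `q`, the frequency bound would hold vacuously with `-1`, making the
    -- measure of a cylinder negative.
    have := (hfreq 0 (fun _ => x.1 0) (-1)).1 fun B hB => absurd hB (hno B)
    linarith [measureReal_nonneg (μ := (ν : Measure X.Pt)) (s := X.cylinder fun _ : Fin 1 => x.1 0)]
  have hBU : Subshift.BlockOrMeasure.block B ∉ U := by
    rw [← hB] at hq
    exact hq
  refine hBU (hthick (Metric.mem_thickening_iff.2 ⟨_, mem_image_of_mem _ hν, ?_⟩))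
  refine hclose _ _ fun l hl C => ?_
  have hcell (B' : X.Block) (hB' : τ B' = q) :
      |freq B'.toFun C - freq B.toFun C| ≤ 1 / ((M : ℝ) + 1) := by
    refine abs_sub_le_of_floor_eq (Subshift.freq_nonneg _ _) (Subshift.freq_nonneg _ _) ?_
    have := congrFun (congrArg Prod.snd (hB'.trans hB.symm)) ⟨⟨l, hl⟩, C⟩
    exact congrArg Fin.val this
  change |freq B.toFun C - (ν : Measure X.Pt).real (X.cylinder C)| ≤ _
  -- All blocks of type `q` share the rounding cell of `B`, so the frequency in `B` shifted by the
  -- mesh either way bounds theirs, and thereby `ν`.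
  have h1 := (hfreq l C (freq B.toFun C + 1 / ((M : ℝ) + 1))).1 fun B' hB' => by
    linarith [(abs_le.1 (hcell B' hB')).2]
  have h2 := (hfreq l C (freq B.toFun C - 1 / ((M : ℝ) + 1))).2 fun B' hB' => by
    linarith [(abs_le.1 (hcell B' hB')).1]
  rw [abs_le]
  constructor <;> linarith

end Types

end Symbolic

end

theorem theorem2p9 {Λ : Type*} [Fintype Λ] [TopologicalSpace Λ] [DiscreteTopology Λ]
    [MeasurableSpace Λ] [BorelSpace Λ] :
    (∀ (X : Symbolic.Subshift ℤ Λ), X.IsBauer →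
      ∀ U : Set X.BlockOrMeasure, IsOpen U →
        (∀ μ ∈ X.ergodicMeasures, Symbolic.Subshift.BlockOrMeasure.measure μ ∈ U) →
      ∀ ε : ℝ, 0 < ε → ∃ k₀ : ℕ, ∀ (x : X.Pt) (D : Symbolic.Decomposition ℤ),
        (∀ j, k₀ ≤ D.length j) → (∃ K : ℕ, ∀ j, D.length j ≤ K) →
        Symbolic.upperBanachDensity (D.nonergodicCoords X U x) < ε) ∧
    (∀ (X : Symbolic.Subshift ℕ Λ), X.IsBauer →
      ∀ U : Set X.BlockOrMeasure, IsOpen U →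
        (∀ μ ∈ X.ergodicMeasures, Symbolic.Subshift.BlockOrMeasure.measure μ ∈ U) →
      ∀ ε : ℝ, 0 < ε → ∃ k₀ : ℕ, ∀ (x : X.Pt) (D : Symbolic.Decomposition ℕ),
        (∀ j, k₀ ≤ D.length j) → (∃ K : ℕ, ∀ j, D.length j ≤ K) →
        Symbolic.upperBanachDensity (D.nonergodicCoords X U x) < ε) := by
  refine ⟨fun X hX U hU hUerg ε hε => ?_, fun X hX U hU hUerg ε hε => ?_⟩
  · exact Symbolic.exists_length_upperBanachDensity_nonergodicCoords_lt
      (fun a b hab => ⟨(b - a).toNat, by simp; omega⟩) hX hU hUerg hε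
  · exact Symbolic.exists_length_upperBanachDensity_nonergodicCoords_lt
      (fun a b hab => ⟨b - a, by simp; omega⟩) hX hU hUerg hε
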